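/- All sets are finite and all Hilbert spaces are finite-dimensional and nonzero. For a Hilbert space $\mathcal H$ let $L(\mathcal H)$ be the linear operators on $\mathcal H$; a density operator is a $\rho\ge 0$ in $L(\mathcal H)$ with $\operatorname{Tr}\rho=1$; a POVM with outcome set $\mathcal U$ is a family $(P^u)_{u\in\mathcal U}$ of positive semidefinite operators with $\sum_u P^u=\mathbb 1$; CPTP means completely positive, trace-preserving and linear. For a cq-state $\omega_{UA}=\sum_{u\in\mathcal U}q(u)|u\rangle\langle u|_U\otimes\omega^u_A$, with $q$ a probability distribution and each $\omega^u_A$ a density operator on $\mathcal H_A$, put $$P_{\rm guess}(U|A)_\omega=\max_{P}\sum_{u\in\mathcal U}q(u)\operatorname{Tr}[\omega^u_A\,P^u],$$ the maximum being over all POVMs $P=(P^u)_{u\in\mathcal U}$ on $\mathcal H_A$, and $$H_{\min}(U|A)_\omega=-\inf\{\lambda\in\mathbb R:\ \omega_{UA}\le 2^{\lambda}\,\mathbb 1_U\otimes\sigma_A\ \text{for some density operator }\sigma_A\text{ on }\mathcal H_A\}.$$ **Corollary.** Let $\mathcal N:L(\mathcal H_Q)\to L(\mathcal H_R)$ and $\mathcal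 N':L(\mathcal H_Q)\to L(\mathcal H_S)$ be two CPTP maps, and let $\mathcal H_{S'}$ be an auxiliary Hilbert space with $\mathcal H_{S'}\cong\mathcal H_S$. For a finite set $\mathcal U$, a probability distribution $q$ on $\mathcal U$ and density operators $\rho^u_{S'Q}$, $u\in\mathcal U$, on $\mathcal H_{S'}\otimes\mathcal H_Q$, let $$\sigma_{US'R}=\sum_{u}q(u)|u\rangle\langle u|_U\otimes(\mathsf{id}_{S'}\otimes\mathcal N)(\rho^u_{S'Q}),\qquad \tau_{US'S}=\sum_{u}q(u)|u\rangle\langle u|_U\otimes(\mathsf{id}_{S'}\otimes\mathcal N')(\rho^u_{S'Q}).$$ The following are equivalent: 1. $H_{\min}(U|S'R)_\sigma\le H_{\min}(U|S'S)_\tau$ for all such $\mathcal U$, $q$ and $(\rho^u_{S'Q})_{u\in\mathcal U}$; 2. $P_{\rm guess}(U|S'R)_\sigma\ge P_{\rm guess}(U|S'S)_\tau$ for all such $\mathcal U$, $q$ and $(\rho^u_{S'Q})_{u\in\mathcal U}$; 3. $\mathcal N$ is degradable into $\mathcal N'$: there is a CPTP map $\mathcal T:L(\mathcal H_R)\to L(\mathcal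 H_S)$ with $\mathcal N'=\mathcal T\circ\mathcal N$. -/

import Mathlib

open scoped Kronecker ComplexOrder

/-! Finite-dimensional Hilbert spaces are taken in coordinates: a finite type `q` stands for an
orthonormal basis of `ℋ_Q`, the operators `L(ℋ_Q)` are `Matrix q q ℂ`, and `ℋ_A ⊗ ℋ_B` has the
basis `a × b`. -/

namespace QuantumComparison

/-- Density operators: positive semidefinite with unit trace. -/
def IsDensity {q : Type*} [Fintype q] (ρ : Matrix q q ℂ) : Prop :=
  ρ.PosSemidef ∧ ρ.trace = 1

/-- Positive-operator valued measures with finite outcome set `u`. -/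
def IsPOVM {u q : Type*} [Fintype u] [Fintype q] [DecidableEq q] (P : u → Matrix q q ℂ) : Prop :=
  (∀ x, (P x).PosSemidef) ∧ ∑ x, P x = 1

/-- Probability distributions on a finite set. -/
def IsProbDist {u : Type*} [Fintype u] (p : u → ℝ) : Prop :=
  (∀ x, 0 ≤ p x) ∧ ∑ x, p x = 1

/-- The map `id_A ⊗ N : L(ℋ_A ⊗ ℋ_Q) → L(ℋ_A ⊗ ℋ_R)`: it applies `N` to each of the `a × a` blocks
of a matrix on `ℋ_A ⊗ ℋ_Q`. -/
def idTensor (a : Type*) {q r : Type*} (N : Matrix q q ℂ →ₗ[ℂ] Matrix r r ℂ) :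
    Matrix (a × q) (a × q) ℂ →ₗ[ℂ] Matrix (a × r) (a × r) ℂ where
  toFun M := Matrix.of fun x y => N (Matrix.of fun i j => M (x.1, i) (y.1, j)) x.2 y.2
  map_add' M M' := by
    ext x y
    exact congrFun (congrFun (N.map_add (Matrix.of fun i j => M (x.1, i) (y.1, j))
      (Matrix.of fun i j => M' (x.1, i) (y.1, j))) x.2) y.2
  map_smul' c M := by
    ext x y
    exact congrFun (congrFun (N.map_smul c (Matrix.of fun i j => M (x.1, i) (y.1, j))) x.2) y.2

/-- `idTensor` is characterized by its action on product operators. -/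
theorem idTensor_kronecker {a q r : Type*} (N : Matrix q q ℂ →ₗ[ℂ] Matrix r r ℂ)
    (A : Matrix a a ℂ) (X : Matrix q q ℂ) : idTensor a N (A ⊗ₖ X) = A ⊗ₖ N X := by
  ext x y
  exact congrFun (congrFun (N.map_smul (A x.1 y.1) X) x.2) y.2

/-- Complete positivity: `id_k ⊗ N` is positive for every `k`. -/
def IsCompletelyPositive {q r : Type*} [Fintype q] [Fintype r]
    (N : Matrix q q ℂ →ₗ[ℂ] Matrix r r ℂ) : Prop :=
  ∀ (k : ℕ) (M : Matrix (Fin k × q) (Fin k × q) ℂ),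
    M.PosSemidef → (idTensor (Fin k) N M).PosSemidef

/-- Completely positive trace-preserving linear maps, i.e. quantum channels. -/
def IsCPTP {q r : Type*} [Fintype q] [Fintype r]
    (N : Matrix q q ℂ →ₗ[ℂ] Matrix r r ℂ) : Prop :=
  IsCompletelyPositive N ∧ ∀ X, (N X).trace = X.trace

/-- `N` is degradable into `N'`. -/
def IsDegradableInto {q r s : Type*} [Fintype r] [Fintype s]
    (N : Matrix q q ℂ →ₗ[ℂ] Matrix r r ℂ) (N' : Matrix q q ℂ →ₗ[ℂ] Matrix s s ℂ) : Prop :=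
  ∃ T : Matrix r r ℂ →ₗ[ℂ] Matrix s s ℂ, IsCPTP T ∧ N' = T ∘ₗ N

/-- The classical-quantum state `∑ₓ p(x) |x⟩⟨x| ⊗ ρˣ`. -/
noncomputable def cqState {u q : Type*} [Fintype u] [DecidableEq u] (p : u → ℝ)
    (ρ : u → Matrix q q ℂ) : Matrix (u × q) (u × q) ℂ :=
  ∑ x, (p x : ℂ) • (Matrix.single x x (1 : ℂ) ⊗ₖ ρ x)

/-- The guessing probability `P_guess(X|Q) = max_P ∑ₓ p(x) Tr[ρˣ Pˣ]` of the ensemble `(p, ρ)`, the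
maximum being over all POVMs on `ℋ_Q` with outcomes in the range of `X`. -/
noncomputable def pGuess {u q : Type*} [Fintype u] [Fintype q] [DecidableEq q] (p : u → ℝ)
    (ρ : u → Matrix q q ℂ) : ℝ :=
  sSup {g : ℝ | ∃ P : u → Matrix q q ℂ, IsPOVM P ∧ g = ∑ x, p x * ((ρ x * P x).trace).re}

/-- The conditional min-entropy `H_min(A|Q)` of a bipartite state `ρ` on `ℋ_A ⊗ ℋ_Q`:
minus the infimum of all `t` such that `ρ ≤ 2ᵗ 1 ⊗ σ` for some density operator `σ` on `ℋ_Q`. -/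
noncomputable def condMinEntropy {a q : Type*} [Fintype a] [DecidableEq a] [Fintype q]
    (ρ : Matrix (a × q) (a × q) ℂ) : ℝ :=
  -sInf {t : ℝ | ∃ σ : Matrix q q ℂ, IsDensity σ ∧
    ((((2 : ℝ) ^ t : ℝ) : ℂ) • ((1 : Matrix a a ℂ) ⊗ₖ σ) - ρ).PosSemidef}

end QuantumComparison

/-! A guessing game is a semidefinite program whose dual reads: `P_guess ≤ g` iff
`p(x) ρˣ ≤ g σ` for all `x` and a single density `σ`. Hence `H_min = -log₂ P_guess`, and positive
trace-preserving maps can only lower `P_guess`.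

For the converse, fix a measurement `Q` after `N'`. The pairing of measurements with ensembles is
bilinear, so by the minimax theorem the pointwise comparison of guessing probabilities yields one
measurement `P` after `N` that does at least as well as `Q` on every ensemble. On ensembles
concentrated at one outcome this bounds each outcome probability of `Q` by that of `P`, and both
distributions sum to one, so `P` after `N` and `Q` after `N'` have the same statistics.

Take for `Q` the Bell measurement on `ℋ_S ⊗ ℋ_S` and run teleportation with `P` in place of `Q`:
teleporting the output of `N'` gives `N'` back, while the same protocol applied to the output of
`N` is a fixed channel `T`, so `N' = T ∘ N`. -/

namespace QuantumComparison

open scoped Matrix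

section Minimax

theorem exists_weights_of_forall_exists_lt {ι : Type*} [Fintype ι] {K : Set (ι → ℝ)}
    (hK : IsCompact K) (hconv : Convex ℝ K) {c : ι → ℝ} (h : ∀ z ∈ K, ∃ i, z i < c i) :
    ∃ w : ι → ℝ, 0 ≤ w ∧ ∀ z ∈ K, ∑ i, w i * z i < ∑ i, w i * c i := by
  classical
  have hdisj : Disjoint K (Set.Ici c) := Set.disjoint_left.2 fun z hz hcz =>
    have ⟨i, hi⟩ := h z hz
    hi.not_ge (hcz i)
  obtain ⟨f, a, b, hfK, hab, hfc⟩ :=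
    geometric_hahn_banach_compact_closed hconv hK (convex_Ici c) isClosed_Ici hdisj
  have hf : ∀ z, f z = ∑ i, f (Pi.single i 1) * z i := fun z => by
    conv_lhs => rw [← Finset.univ_sum_single z]
    simp_rw [map_sum, mul_comm, ← smul_eq_mul, ← map_smul, ← Pi.single_smul, smul_eq_mul, mul_one]
  refine ⟨fun i => f (Pi.single i 1), fun i => ?_, fun z hz => ?_⟩
  · by_contra! hneg
    change f (Pi.single i 1) < 0 at hneg
    have hle : c ≤ c + ((f c - b) / -f (Pi.single i 1)) • Pi.single i 1 :=
      le_add_of_nonneg_right (smul_nonneg (div_nonneg (sub_nonneg.2 (hfc c Set.self_mem_Ici).le)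
        (neg_nonneg.2 hneg.le)) (Pi.single_nonneg.2 zero_le_one))
    have hfar := hfc _ hle
    rw [map_add, map_smul, smul_eq_mul, div_neg, neg_mul, div_mul_cancel₀ _ hneg.ne] at hfar
    linarith
  · rw [← hf, ← hf]
    exact (hfK z hz).trans (hab.trans (hfc c Set.self_mem_Ici))

variable {E F : Type*} [AddCommGroup E] [Module ℝ E] [TopologicalSpace E]
  [AddCommGroup F] [Module ℝ F]

/-- If no point of `X` worked for all of `Y`, compactness would leave finitely many `y` excluding
all of `X`, and a convex combination of these `y` would exclude every point of `X` at once. -/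
theorem exists_forall_le_of_forall_exists_le {X : Set E} {Y : Set F} (hXc : IsCompact X)
    (hX : Convex ℝ X) (hXne : X.Nonempty) (hY : Convex ℝ Y) {B : E →ₗ[ℝ] F →ₗ[ℝ] ℝ}
    (hB : ∀ y, Continuous fun x => B x y) {φ : F →ₗ[ℝ] ℝ}
    (h : ∀ y ∈ Y, ∃ x ∈ X, φ y ≤ B x y) : ∃ x ∈ X, ∀ y ∈ Y, φ y ≤ B x y := by
  by_contra! hlt
  obtain ⟨t, ht⟩ := hXc.elim_finite_subcover (fun y : Y => {x | B x y < φ y})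
    (fun y => isOpen_lt (hB y) continuous_const) fun x hx => by
      obtain ⟨y, hy, hxy⟩ := hlt x hx
      exact Set.mem_iUnion.2 ⟨⟨y, hy⟩, hxy⟩
  let Φ : E →ₗ[ℝ] t → ℝ := LinearMap.pi fun y => B.flip y
  obtain ⟨w, hw, hwX⟩ := exists_weights_of_forall_exists_lt
    (hXc.image (f := Φ) (continuous_pi fun y => hB y)) (hX.linear_image Φ)
    (c := fun y => φ y) (by
      rintro _ ⟨x, hx, rfl⟩
      obtain ⟨y, hy, hxy⟩ := Set.mem_iUnion₂.1 (ht hx)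
      exact ⟨⟨y, hy⟩, hxy⟩)
  simp only [Set.forall_mem_image] at hwX
  have hΛ : 0 < ∑ y, w y := by
    refine (Finset.sum_nonneg fun y _ => hw y).lt_of_ne fun h0 => ?_
    have hw0 : ∀ y, w y = 0 := fun y =>
      (Finset.sum_eq_zero_iff_of_nonneg fun y _ => hw y).1 h0.symm y (Finset.mem_univ y)
    obtain ⟨x, hx⟩ := hXne
    simpa [hw0] using hwX hx
  obtain ⟨x, hx, hxy⟩ := h _ (hY.centerMass_mem (fun y _ => hw y) hΛ
    fun (y : t) _ => y.1.2)
  refine hxy.not_gt ?_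
  simp only [Finset.centerMass, map_smul, map_sum, smul_eq_mul]
  exact mul_lt_mul_of_pos_left (hwX hx) (inv_pos.2 hΛ)

end Minimax

section PosSemidef

variable {n : Type*} [Fintype n]

open scoped Matrix.Norms.L2Operator MatrixOrder in
theorem trace_mul_nonneg {A B : Matrix n n ℂ} (hA : A.PosSemidef) (hB : B.PosSemidef) :
    0 ≤ (A * B).trace := by
  classical
  obtain ⟨C, rfl⟩ := CStarAlgebra.nonneg_iff_eq_star_mul_self.1 hB.nonneg
  rw [Matrix.star_eq_conjTranspose, ← Matrix.mul_assoc, Matrix.trace_mul_comm, ← Matrix.mul_assoc]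
  exact (hA.mul_mul_conjTranspose_same C).trace_nonneg

theorem ofReal_re_trace {A : Matrix n n ℂ} (hA : A.PosSemidef) : (A.trace.re : ℂ) = A.trace :=
  (Complex.eq_re_of_ofReal_le hA.trace_nonneg).symm

theorem re_trace_nonneg {A : Matrix n n ℂ} (hA : A.PosSemidef) : 0 ≤ A.trace.re :=
  (Complex.le_def.1 hA.trace_nonneg).1

theorem norm_apply_le_re_trace {A : Matrix n n ℂ} (hA : A.PosSemidef) (i j : n) :
    ‖A i j‖ ≤ A.trace.re := by
  have hdiag : ∀ k, 0 ≤ (A k k).re ∧ (A k k).re ≤ A.trace.re := fun k =>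
    ⟨(Complex.le_def.1 hA.diag_nonneg).1, by
      rw [Matrix.trace, Complex.re_sum]
      exact Finset.single_le_sum (f := fun k => (A k k).re)
        (fun k _ => (Complex.le_def.1 hA.diag_nonneg).1) (Finset.mem_univ k)⟩
  have hreal : ∀ k, A k k = (A k k).re := fun k => Complex.eq_re_of_ofReal_le hA.diag_nonneg
  have hminor : ‖A i j‖ ^ 2 ≤ (A i i).re * (A j j).re := by
    have hdet := (hA.submatrix ![i, j]).det_nonneg
    rw [Matrix.det_fin_two] at hdet
    simp only [Matrix.submatrix_apply, Matrix.cons_val_zero, Matrix.cons_val_one] at hdet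
    rw [← hA.isHermitian.apply j i, Complex.star_def, Complex.mul_conj', hreal i, hreal j] at hdet
    exact_mod_cast sub_nonneg.1 hdet
  refine le_of_sq_le_sq ?_ ((hdiag i).1.trans (hdiag i).2)
  rw [sq A.trace.re]
  exact hminor.trans (mul_le_mul (hdiag i).2 (hdiag j).2 (hdiag j).1
    ((hdiag i).1.trans (hdiag i).2))

theorem isClosed_setOf_posSemidef {n : Type*} [Finite n] :
    IsClosed {A : Matrix n n ℂ | A.PosSemidef} := by
  cases nonempty_fintype n
  simp only [Matrix.posSemidef_iff_dotProduct_mulVec, Set.ofPred_and, Set.ofPred_forall]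
  exact (isClosed_eq (by fun_prop) continuous_id).inter
    (isClosed_iInter fun x => isClosed_le continuous_const (by fun_prop))

theorem isCompact_setOf_posSemidef_re_trace_le (c : ℝ) :
    IsCompact {A : Matrix n n ℂ | A.PosSemidef ∧ A.trace.re ≤ c} := by
  refine (isCompact_univ_pi fun _ => isCompact_univ_pi fun _ =>
    isCompact_closedBall (0 : ℂ) c).of_isClosed_subset ?_ fun A hA i _ j _ => ?_
  · exact isClosed_setOf_posSemidef.inter (isClosed_le
      (Complex.continuous_re.comp (Continuous.matrix_trace continuous_id)) continuous_const)
  · exact mem_closedBall_zero_iff.2 ((norm_apply_le_re_trace hA.1 i j).trans hA.2)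

end PosSemidef

theorem posSemidef_single_one {n : Type*} [DecidableEq n] (i : n) :
    (Matrix.single i i (1 : ℂ)).PosSemidef := by
  rw [← Matrix.diagonal_single]
  exact .diagonal (Pi.single_nonneg.2 zero_le_one)

theorem posSemidef_piSingle {u n : Type*} [DecidableEq u] {A : Matrix n n ℂ}
    (hA : A.PosSemidef) (x₀ x : u) : ((Pi.single x₀ A : u → Matrix n n ℂ) x).PosSemidef := by
  obtain rfl | hx := eq_or_ne x x₀
  · rwa [Pi.single_eq_same]
  · rw [Pi.single_eq_of_ne hx]
    exact .zero

section Density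

variable {n : Type*} [Fintype n]

theorem IsDensity.nonempty {ρ : Matrix n n ℂ} (hρ : IsDensity ρ) : Nonempty n := by
  by_contra h
  rw [not_nonempty_iff] at h
  simpa [Matrix.trace] using hρ.2

theorem exists_isDensity [Nonempty n] : ∃ ρ : Matrix n n ℂ, IsDensity ρ := by
  classical
  obtain ⟨i⟩ := ‹Nonempty n›
  refine ⟨Matrix.single i i 1, posSemidef_single_one i, Matrix.trace_single_eq_same i 1⟩

theorem exists_isDensity_eq_trace_smul [Nonempty n] {A : Matrix n n ℂ} (hA : A.PosSemidef) :
    ∃ ρ, IsDensity ρ ∧ A = A.trace • ρ := by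
  by_cases htr : A.trace = 0
  · obtain ⟨ρ, hρ⟩ := exists_isDensity (n := n)
    exact ⟨ρ, hρ, by rw [htr, zero_smul, hA.trace_eq_zero_iff.1 htr]⟩
  · refine ⟨A.trace⁻¹ • A, ⟨hA.smul (inv_nonneg.2 hA.trace_nonneg), ?_⟩, ?_⟩
    · rw [Matrix.trace_smul, smul_eq_mul, inv_mul_cancel₀ htr]
    · rw [smul_inv_smul₀ htr]

theorem posSemidef_of_forall_isDensity {A : Matrix n n ℂ} (hA : A.IsHermitian)
    (h : ∀ ρ, IsDensity ρ → 0 ≤ (A * ρ).trace.re) : A.PosSemidef := by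
  refine .of_dotProduct_mulVec_nonneg hA fun v => ?_
  have him := hA.im_star_dotProduct_mulVec_self v
  refine Complex.le_def.2 ⟨?_, by simpa using him.symm⟩
  cases isEmpty_or_nonempty n
  · simp
  obtain ⟨ρ, hρ, hvρ⟩ := exists_isDensity_eq_trace_smul (Matrix.posSemidef_vecMulVec_self_star v)
  have hquad : star v ⬝ᵥ A.mulVec v = (A * Matrix.vecMulVec v (star v)).trace := by
    rw [Matrix.mul_vecMulVec, Matrix.trace_vecMulVec, dotProduct_comm]
  rw [hquad, hvρ, Matrix.mul_smul, Matrix.trace_smul,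
    ← ofReal_re_trace (Matrix.posSemidef_vecMulVec_self_star v), smul_eq_mul,
    Complex.re_ofReal_mul]
  exact mul_nonneg (re_trace_nonneg (Matrix.posSemidef_vecMulVec_self_star v))
    (h ρ hρ)

open scoped Matrix.Norms.L2Operator MatrixOrder in
theorem linearMap_ext_of_isDensity {E : Type*} [AddCommGroup E] [Module ℂ E]
    {f g : Matrix n n ℂ →ₗ[ℂ] E} (h : ∀ ρ, IsDensity ρ → f ρ = g ρ) : f = g := by
  classical
  cases isEmpty_or_nonempty n
  · exact LinearMap.ext fun A => by rw [Subsingleton.elim A 0, map_zero, map_zero]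
  refine LinearMap.ext_on (CStarAlgebra.span_nonneg (A := Matrix n n ℂ)) fun A hA => ?_
  obtain ⟨ρ, hρ, hAρ⟩ := exists_isDensity_eq_trace_smul (Matrix.nonneg_iff_posSemidef.1 hA)
  rw [hAρ, map_smul, map_smul, h ρ hρ]

theorem convex_setOf_isDensity : Convex ℝ {ρ : Matrix n n ℂ | IsDensity ρ} := by
  intro ρ hρ σ hσ a b ha hb hab
  refine ⟨(hρ.1.smul ha).add (hσ.1.smul hb), ?_⟩
  rw [Matrix.trace_add, Matrix.trace_smul, Matrix.trace_smul, hρ.2, hσ.2, ← add_smul, hab,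
    one_smul]

theorem isCompact_setOf_isDensity : IsCompact {ρ : Matrix n n ℂ | IsDensity ρ} := by
  refine (isCompact_setOf_posSemidef_re_trace_le 1).of_isClosed_subset ?_
    fun ρ hρ => ⟨hρ.1, by simp [hρ.2]⟩
  exact isClosed_setOf_posSemidef.inter
    (isClosed_eq (Continuous.matrix_trace continuous_id) continuous_const)

/-- A density maximizing `Re Tr[S σ]` lives on the top eigenspace of `S`. -/
theorem exists_isDensity_posSemidef_trace_smul_one_sub [Nonempty n] [DecidableEq n]
    {S : Matrix n n ℂ} (hS : S.IsHermitian) :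
    ∃ σ, IsDensity σ ∧ ((S * σ).trace.re • (1 : Matrix n n ℂ) - S).PosSemidef := by
  obtain ⟨σ, hσ, hmax⟩ := (isCompact_setOf_isDensity (n := n)).exists_isMaxOn exists_isDensity
    (f := fun ρ => (S * ρ).trace.re) (by fun_prop)
  refine ⟨σ, hσ, posSemidef_of_forall_isDensity
    ((Matrix.isHermitian_one.smul (IsSelfAdjoint.all _)).sub hS) fun ρ hρ => ?_⟩
  rw [Matrix.sub_mul, Matrix.trace_sub, Matrix.smul_mul, one_mul, Matrix.trace_smul, hρ.2,
    Complex.sub_re, Complex.smul_re, Complex.one_re, smul_eq_mul, mul_one, sub_nonneg]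
  exact hmax hρ

end Density

section Pairing

variable {u n : Type*} [Fintype u] [Fintype n]

/-- The real Hilbert–Schmidt pairing `∑ₓ Re Tr[Aˣ Bˣ]` of two families of operators; the score of a
measurement in a guessing game is its pairing with the ensemble. -/
noncomputable def hsPairing : (u → Matrix n n ℂ) →ₗ[ℝ] (u → Matrix n n ℂ) →ₗ[ℝ] ℝ :=
  LinearMap.mk₂ ℝ (fun A B => ∑ x, (A x * B x).trace.re)
    (fun A A' B => by simp [add_mul, Finset.sum_add_distrib])
    (fun c A B => by simp [Finset.mul_sum])
    (fun A B B' => by simp [mul_add, Finset.sum_add_distrib])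
    (fun c A B => by simp [Finset.mul_sum])

theorem hsPairing_apply (A B : u → Matrix n n ℂ) :
    hsPairing A B = ∑ x, (A x * B x).trace.re := rfl

theorem hsPairing_comm (A B : u → Matrix n n ℂ) : hsPairing A B = hsPairing B A := by
  simp only [hsPairing_apply, fun x => Matrix.trace_mul_comm (A x) (B x)]

theorem hsPairing_single_right [DecidableEq u] (A : u → Matrix n n ℂ) (x : u)
    (B : Matrix n n ℂ) : hsPairing A (Pi.single x B) = (A x * B).trace.re := by
  rw [hsPairing_apply, Finset.sum_eq_single x (fun y _ hy => by simp [hy]) (by simp),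
    Pi.single_eq_same]

theorem hsPairing_single_left [DecidableEq u] (x : u) (A : Matrix n n ℂ)
    (B : u → Matrix n n ℂ) : hsPairing (Pi.single x A) B = (A * B x).trace.re := by
  rw [hsPairing_comm, hsPairing_single_right, Matrix.trace_mul_comm]

theorem hsPairing_const_left (A : Matrix n n ℂ) (B : u → Matrix n n ℂ) :
    hsPairing (fun _ => A) B = (A * ∑ x, B x).trace.re := by
  rw [hsPairing_apply, Matrix.mul_sum, Matrix.trace_sum, Complex.re_sum]

theorem hsPairing_le_hsPairing_right {A B B' : u → Matrix n n ℂ} (hA : ∀ x, (A x).PosSemidef)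
    (h : ∀ x, (B' x - B x).PosSemidef) : hsPairing A B ≤ hsPairing A B' := by
  rw [← sub_nonneg, ← map_sub]
  exact Finset.sum_nonneg fun x _ => (Complex.le_def.1 (trace_mul_nonneg (hA x) (h x))).1

theorem continuous_hsPairing_left (B : u → Matrix n n ℂ) :
    Continuous fun A => hsPairing A B := by
  simp only [hsPairing_apply]
  fun_prop

end Pairing

section POVM

variable {u n : Type*} [Fintype u] [Fintype n] [DecidableEq n]

theorem exists_isPOVM_posSemidef_smul_sub [Nonempty u] {P : u → Matrix n n ℂ}
    (hP : ∀ x, (P x).PosSemidef) {m : ℝ} (hm : 0 < m)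
    (hle : (m • (1 : Matrix n n ℂ) - ∑ x, P x).PosSemidef) :
    ∃ P' : u → Matrix n n ℂ, IsPOVM P' ∧ ∀ x, (m • P' x - P x).PosSemidef := by
  classical
  obtain ⟨x₀⟩ := ‹Nonempty u›
  have hrest := posSemidef_piSingle hle x₀
  refine ⟨fun x => m⁻¹ • (P x + (Pi.single x₀ (m • 1 - ∑ x, P x) : u → Matrix n n ℂ) x),
    ⟨fun x => ((hP x).add (hrest x)).smul (inv_nonneg.2 hm.le), ?_⟩, fun x => ?_⟩
  · rw [← Finset.smul_sum, Finset.sum_add_distrib, Fintype.sum_pi_single', add_sub_cancel,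
      inv_smul_smul₀ hm.ne']
  · rw [smul_inv_smul₀ hm.ne', add_sub_cancel_left]
    exact hrest x

theorem exists_isPOVM [Nonempty u] : ∃ P : u → Matrix n n ℂ, IsPOVM P := by
  obtain ⟨P, hP, -⟩ := exists_isPOVM_posSemidef_smul_sub (u := u) (P := 0) (n := n)
    (fun _ => .zero) zero_lt_one (by simpa using Matrix.PosSemidef.one)
  exact ⟨P, hP⟩

theorem convex_setOf_isPOVM : Convex ℝ {P : u → Matrix n n ℂ | IsPOVM P} := by
  intro P hP Q hQ a b ha hb hab
  refine ⟨fun x => ((hP.1 x).smul ha).add ((hQ.1 x).smul hb), ?_⟩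
  simp only [Pi.add_apply, Pi.smul_apply]
  rw [Finset.sum_add_distrib, ← Finset.smul_sum, ← Finset.smul_sum, hP.2, hQ.2, ← add_smul, hab,
    one_smul]

theorem IsPOVM.re_trace_le_card {P : u → Matrix n n ℂ} (hP : IsPOVM P) (x : u) :
    (P x).trace.re ≤ Fintype.card n := by
  have htr : ∑ y, (P y).trace.re = Fintype.card n := by
    rw [← Complex.re_sum, ← Matrix.trace_sum, hP.2, Matrix.trace_one, Complex.natCast_re]
  rw [← htr]
  exact Finset.single_le_sum (f := fun y => (P y).trace.re)
    (fun y _ => re_trace_nonneg (hP.1 y)) (Finset.mem_univ x)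

theorem isCompact_setOf_isPOVM : IsCompact {P : u → Matrix n n ℂ | IsPOVM P} := by
  refine (isCompact_univ_pi fun _ => isCompact_setOf_posSemidef_re_trace_le
    (Fintype.card n)).of_isClosed_subset ?_ fun P hP x _ => ⟨hP.1 x, hP.re_trace_le_card x⟩
  simp only [IsPOVM, Set.ofPred_and, Set.ofPred_forall]
  refine .inter (isClosed_iInter fun x => ?_) ?_
  · exact isClosed_setOf_posSemidef.preimage
      (f := fun P : u → Matrix n n ℂ => P x) (continuous_apply x)
  · exact isClosed_eq (continuous_finsetSum _ fun x _ => continuous_apply x) continuous_const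

end POVM

section GuessingProbability

variable {u n : Type*} [Fintype u] [Fintype n]

/-- An ensemble `(p, ρ)` of states in unnormalized form `ωˣ = p(x) ρˣ`, in which ensembles form a
convex set. -/
def IsEnsemble (ω : u → Matrix n n ℂ) : Prop :=
  (∀ x, (ω x).PosSemidef) ∧ ∑ x, (ω x).trace = 1

theorem isEnsemble_smul {p : u → ℝ} {ρ : u → Matrix n n ℂ} (hp : IsProbDist p)
    (hρ : ∀ x, IsDensity (ρ x)) : IsEnsemble fun x => p x • ρ x := by
  refine ⟨fun x => (hρ x).1.smul (hp.1 x), ?_⟩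
  simp only [Matrix.trace_smul, (hρ _).2, Complex.real_smul, mul_one]
  exact_mod_cast hp.2

theorem convex_setOf_isEnsemble : Convex ℝ {ω : u → Matrix n n ℂ | IsEnsemble ω} := by
  intro ω hω ω' hω' a b ha hb hab
  refine ⟨fun x => ((hω.1 x).smul ha).add ((hω'.1 x).smul hb), ?_⟩
  simp only [Pi.add_apply, Pi.smul_apply, Matrix.trace_add, Matrix.trace_smul]
  rw [Finset.sum_add_distrib, ← Finset.smul_sum, ← Finset.smul_sum, hω.2, hω'.2, ← add_smul, hab,
    one_smul]

theorem IsEnsemble.nonempty {ω : u → Matrix n n ℂ} (hω : IsEnsemble ω) : Nonempty u := by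
  by_contra h
  rw [not_nonempty_iff] at h
  simpa using hω.2

theorem IsEnsemble.isDensity_sum {ω : u → Matrix n n ℂ} (hω : IsEnsemble ω) :
    IsDensity (∑ x, ω x) :=
  ⟨Matrix.posSemidef_sum _ fun x _ => hω.1 x, by rw [Matrix.trace_sum, hω.2]⟩

theorem IsEnsemble.exists_eq_smul {ω : u → Matrix n n ℂ} (hω : IsEnsemble ω) :
    ∃ (p : u → ℝ) (ρ : u → Matrix n n ℂ), IsProbDist p ∧ (∀ x, IsDensity (ρ x)) ∧
      ω = fun x => p x • ρ x := by
  have := hω.isDensity_sum.nonempty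
  choose ρ hρ hωρ using fun x => exists_isDensity_eq_trace_smul (hω.1 x)
  refine ⟨fun x => (ω x).trace.re, ρ, ⟨fun x => re_trace_nonneg (hω.1 x), ?_⟩, hρ,
    funext fun x => ?_⟩
  · rw [← Complex.re_sum, hω.2, Complex.one_re]
  · rw [← Complex.coe_smul, ofReal_re_trace (hω.1 x)]
    exact hωρ x

theorem isEnsemble_piSingle [DecidableEq u] {ρ : Matrix n n ℂ} (hρ : IsDensity ρ) (x : u) :
    IsEnsemble (Pi.single x ρ : u → Matrix n n ℂ) := by
  refine ⟨posSemidef_piSingle hρ.1 x, ?_⟩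
  rw [← Matrix.trace_sum, Fintype.sum_pi_single', hρ.2]

variable [DecidableEq n]

theorem hsPairing_le_of_posSemidef_smul_sub {ω : u → Matrix n n ℂ} {σ : Matrix n n ℂ}
    (hσ : IsDensity σ) {g : ℝ} (h : ∀ x, (g • σ - ω x).PosSemidef) {P : u → Matrix n n ℂ}
    (hP : IsPOVM P) : hsPairing ω P ≤ g := by
  calc hsPairing ω P ≤ hsPairing (fun _ => g • σ) P := by
        rw [hsPairing_comm ω, hsPairing_comm _ P]
        exact hsPairing_le_hsPairing_right hP.1 h
    _ = g := by
        rw [hsPairing_const_left, hP.2, mul_one, Matrix.trace_smul, hσ.2, Complex.smul_re,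
          Complex.one_re, smul_eq_mul, mul_one]

theorem IsEnsemble.exists_isDensity_hsPairing_le {ω : u → Matrix n n ℂ}
    (hω : ∀ x, (ω x).PosSemidef) {g : ℝ} (hg : ∀ P, IsPOVM P → hsPairing ω P ≤ g)
    {P : u → Matrix n n ℂ} (hP : IsEnsemble P) :
    ∃ σ, IsDensity σ ∧ hsPairing ω P ≤ g * hsPairing (fun _ => σ) P := by
  have := hP.nonempty
  have := hP.isDensity_sum.nonempty
  obtain ⟨σ, hσ, hle⟩ := exists_isDensity_posSemidef_trace_smul_one_sub
    hP.isDensity_sum.1.isHermitian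
  set m : ℝ := ((∑ x, P x) * σ).trace.re
  have hm_pos : 0 < m := by
    have htr := re_trace_nonneg hle
    rw [Matrix.trace_sub, Matrix.trace_smul, hP.isDensity_sum.2, Matrix.trace_one, Complex.sub_re,
      Complex.smul_re, Complex.natCast_re, Complex.one_re, smul_eq_mul, sub_nonneg] at htr
    exact pos_of_mul_pos_left (one_pos.trans_le htr) (Nat.cast_nonneg _)
  obtain ⟨P', hP', hPP'⟩ := exists_isPOVM_posSemidef_smul_sub hP.1 hm_pos hle
  refine ⟨σ, hσ, ?_⟩
  calc hsPairing ω P ≤ hsPairing ω (m • P') := hsPairing_le_hsPairing_right hω hPP'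
    _ = hsPairing ω P' * m := by rw [map_smul, smul_eq_mul, mul_comm]
    _ ≤ g * m := mul_le_mul_of_nonneg_right (hg P' hP') hm_pos.le
    _ = g * hsPairing (fun _ => σ) P := by rw [hsPairing_const_left, Matrix.trace_mul_comm]

theorem exists_isDensity_posSemidef_smul_sub [Nonempty n] {ω : u → Matrix n n ℂ}
    (hω : ∀ x, (ω x).PosSemidef) {g : ℝ} (hg : ∀ P, IsPOVM P → hsPairing ω P ≤ g) :
    ∃ σ, IsDensity σ ∧ ∀ x, (g • σ - ω x).PosSemidef := by
  classical
  let const : Matrix n n ℂ →ₗ[ℝ] u → Matrix n n ℂ := LinearMap.pi fun _ => LinearMap.id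
  obtain ⟨σ, hσ, hle⟩ := exists_forall_le_of_forall_exists_le isCompact_setOf_isDensity
    convex_setOf_isDensity exists_isDensity convex_setOf_isEnsemble
    (B := g • hsPairing ∘ₗ const) (φ := hsPairing ω)
    (fun P => ((continuous_hsPairing_left P).comp
      (continuous_pi fun _ => continuous_id)).const_smul g)
    (fun P hP => hP.exists_isDensity_hsPairing_le hω hg)
  refine ⟨σ, hσ, fun x => posSemidef_of_forall_isDensity
    ((hσ.1.isHermitian.smul (IsSelfAdjoint.all g)).sub (hω x).isHermitian) fun ρ hρ => ?_⟩
  have hx := hle _ (isEnsemble_piSingle hρ x)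
  rw [Matrix.sub_mul, Matrix.trace_sub, Complex.sub_re, sub_nonneg, Matrix.smul_mul,
    Matrix.trace_smul, Complex.smul_re, ← hsPairing_single_right ω,
    ← hsPairing_single_right (fun _ => σ) x]
  exact hx

variable {p : u → ℝ} {ρ : u → Matrix n n ℂ}

theorem pGuess_eq_sSup_hsPairing (p : u → ℝ) (ρ : u → Matrix n n ℂ) :
    pGuess p ρ = sSup ((fun P => hsPairing (fun x => p x • ρ x) P) '' {P | IsPOVM P}) := by
  simp only [pGuess, hsPairing_apply, Matrix.smul_mul, Matrix.trace_smul, smul_eq_mul,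
    Complex.smul_re, Set.image, eq_comm, Set.mem_ofPred_eq]

theorem pGuess_le_iff (hp : IsProbDist p) (hρ : ∀ x, IsDensity (ρ x)) {g : ℝ} :
    pGuess p ρ ≤ g ↔ ∀ P, IsPOVM P → hsPairing (fun x => p x • ρ x) P ≤ g := by
  have := (isEnsemble_smul hp hρ).nonempty
  obtain ⟨P₀, hP₀⟩ := exists_isPOVM (u := u) (n := n)
  have hbdd := (isCompact_setOf_isPOVM.image
    (hsPairing fun x => p x • ρ x).continuous_of_finiteDimensional).bddAbove
  rw [pGuess_eq_sSup_hsPairing, csSup_le_iff hbdd ⟨_, P₀, hP₀, rfl⟩, Set.forall_mem_image]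
  rfl

theorem exists_isPOVM_pGuess_eq (hp : IsProbDist p) (hρ : ∀ x, IsDensity (ρ x)) :
    ∃ P, IsPOVM P ∧ pGuess p ρ = hsPairing (fun x => p x • ρ x) P := by
  have := (isEnsemble_smul hp hρ).nonempty
  obtain ⟨P, hP, hPg⟩ := (isCompact_setOf_isPOVM.image
    (hsPairing fun x => p x • ρ x).continuous_of_finiteDimensional).sSup_mem
    (Set.Nonempty.image _ exists_isPOVM)
  exact ⟨P, hP, (pGuess_eq_sSup_hsPairing p ρ).trans hPg.symm⟩

theorem pGuess_le_iff_exists_isDensity (hp : IsProbDist p) (hρ : ∀ x, IsDensity (ρ x)) {g : ℝ} :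
    pGuess p ρ ≤ g ↔ ∃ σ, IsDensity σ ∧ ∀ x, (g • σ - p x • ρ x).PosSemidef := by
  have hω := isEnsemble_smul hp hρ
  have := hω.isDensity_sum.nonempty
  rw [pGuess_le_iff hp hρ]
  exact ⟨exists_isDensity_posSemidef_smul_sub hω.1, fun ⟨σ, hσ, hle⟩ P hP =>
    hsPairing_le_of_posSemidef_smul_sub hσ hle hP⟩

theorem pGuess_pos (hp : IsProbDist p) (hρ : ∀ x, IsDensity (ρ x)) : 0 < pGuess p ρ := by
  by_contra! hneg
  obtain ⟨σ, hσ, hle⟩ := (pGuess_le_iff_exists_isDensity hp hρ).1 hneg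
  have htr : ∀ x, p x ≤ 0 := fun x => by
    simpa [hσ.2, (hρ x).2] using re_trace_nonneg (hle x)
  exact (hp.2.ge.trans (Finset.sum_nonpos fun x _ => htr x)).not_gt one_pos

end GuessingProbability

section MinEntropy

variable {u n : Type*} [Fintype u] [DecidableEq u] [Fintype n]

theorem posSemidef_smul_one_kronecker_sub_cqState_iff {n : Type*} [Finite n] {p : u → ℝ}
    {ρ : u → Matrix n n ℂ} {c : ℝ} {σ : Matrix n n ℂ} :
    ((c : ℂ) • ((1 : Matrix u u ℂ) ⊗ₖ σ) - cqState p ρ).PosSemidef ↔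
      ∀ x, (c • σ - p x • ρ x).PosSemidef := by
  cases nonempty_fintype n
  have hblock : (c : ℂ) • ((1 : Matrix u u ℂ) ⊗ₖ σ) - cqState p ρ =
      ∑ x, Matrix.single x x (1 : ℂ) ⊗ₖ (c • σ - p x • ρ x) := by
    ext ⟨i, k⟩ ⟨j, l⟩
    obtain rfl | hij := eq_or_ne i j
    · simp [cqState, Matrix.sum_apply, Matrix.single_apply]
    · simp [cqState, Matrix.sum_apply, Matrix.single_apply, ite_and, hij]
  rw [hblock]
  refine ⟨fun h x => ?_, fun h => Matrix.posSemidef_sum _ fun x _ => .kronecker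
    (posSemidef_single_one x) (h x)⟩
  · convert h.submatrix (fun i => (x, i)) using 1
    ext i j
    simp [Matrix.sum_apply, Matrix.kroneckerMap_apply, Matrix.single_apply]

theorem condMinEntropy_cqState [DecidableEq n] {p : u → ℝ} {ρ : u → Matrix n n ℂ}
    (hp : IsProbDist p) (hρ : ∀ x, IsDensity (ρ x)) :
    condMinEntropy (cqState p ρ) = -Real.logb 2 (pGuess p ρ) := by
  have hexp : ∀ t : ℝ, (∃ σ : Matrix n n ℂ, IsDensity σ ∧
      ((((2 : ℝ) ^ t : ℝ) : ℂ) • ((1 : Matrix u u ℂ) ⊗ₖ σ) - cqState p ρ).PosSemidef) ↔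
      Real.logb 2 (pGuess p ρ) ≤ t := fun t => by
    rw [Real.logb_le_iff_le_rpow one_lt_two (pGuess_pos hp hρ),
      pGuess_le_iff_exists_isDensity hp hρ]
    exact exists_congr fun σ => and_congr_right' posSemidef_smul_one_kronecker_sub_cqState_iff
  simp only [condMinEntropy, hexp]
  exact congrArg Neg.neg csInf_Ici

theorem condMinEntropy_cqState_le_iff [DecidableEq n] {m : Type*} [Fintype m] [DecidableEq m]
    {p : u → ℝ} {ρ : u → Matrix n n ℂ} {τ : u → Matrix m m ℂ} (hp : IsProbDist p)
    (hρ : ∀ x, IsDensity (ρ x)) (hτ : ∀ x, IsDensity (τ x)) :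
    condMinEntropy (cqState p ρ) ≤ condMinEntropy (cqState p τ) ↔ pGuess p τ ≤ pGuess p ρ := by
  rw [condMinEntropy_cqState hp hρ, condMinEntropy_cqState hp hτ, neg_le_neg_iff,
    Real.logb_le_logb one_lt_two (pGuess_pos hp hτ) (pGuess_pos hp hρ)]

end MinEntropy

theorem idTensor_comp_apply {a q r s : Type*} (T : Matrix r r ℂ →ₗ[ℂ] Matrix s s ℂ)
    (N : Matrix q q ℂ →ₗ[ℂ] Matrix r r ℂ) (M : Matrix (a × q) (a × q) ℂ) :
    idTensor a (T ∘ₗ N) M = idTensor a T (idTensor a N M) := rfl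

section Channels

variable {a u m q r s : Type*} [Fintype a] [Fintype u] [Fintype m] [Fintype q] [Fintype r]
  [Fintype s]

/-- Positive trace-preserving linear maps: the part of the channel property that acts on ensembles
and measurements of a single system. -/
structure IsPositiveTracePreserving (C : Matrix m m ℂ →ₗ[ℂ] Matrix r r ℂ) : Prop where
  posSemidef : ∀ {A}, A.PosSemidef → (C A).PosSemidef
  trace_apply : ∀ A, (C A).trace = A.trace

theorem IsPositiveTracePreserving.isDensity {C : Matrix m m ℂ →ₗ[ℂ] Matrix r r ℂ}
    (hC : IsPositiveTracePreserving C) {ρ : Matrix m m ℂ} (hρ : IsDensity ρ) : IsDensity (C ρ) :=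
  ⟨hC.posSemidef hρ.1, by rw [hC.trace_apply, hρ.2]⟩

theorem IsPositiveTracePreserving.pGuess_le [DecidableEq m] [DecidableEq r]
    {C : Matrix m m ℂ →ₗ[ℂ] Matrix r r ℂ} (hC : IsPositiveTracePreserving C) {p : u → ℝ}
    (hp : IsProbDist p) {ρ : u → Matrix m m ℂ} (hρ : ∀ x, IsDensity (ρ x)) :
    pGuess p (fun x => C (ρ x)) ≤ pGuess p ρ := by
  obtain ⟨σ, hσ, hle⟩ := (pGuess_le_iff_exists_isDensity hp hρ).1 le_rfl
  refine (pGuess_le_iff_exists_isDensity hp fun x => hC.isDensity (hρ x)).2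
    ⟨C σ, hC.isDensity hσ, fun x => ?_⟩
  simpa only [map_sub, LinearMap.map_smul_of_tower] using hC.posSemidef (hle x)

theorem IsCompletelyPositive.posSemidef_idTensor {a : Type*} [Finite a]
    {N : Matrix q q ℂ →ₗ[ℂ] Matrix r r ℂ} (hN : IsCompletelyPositive N)
    {M : Matrix (a × q) (a × q) ℂ} (hM : M.PosSemidef) : (idTensor a N M).PosSemidef := by
  let e := Finite.equivFin a
  convert (hN _ _ (hM.submatrix (Prod.map e.symm id))).submatrix
    (Prod.map e id : a × r → Fin (Nat.card a) × r) using 1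
  ext x y
  simp [idTensor]

theorem trace_idTensor {N : Matrix q q ℂ →ₗ[ℂ] Matrix r r ℂ}
    (hN : ∀ X, (N X).trace = X.trace) (M : Matrix (a × q) (a × q) ℂ) :
    (idTensor a N M).trace = M.trace := by
  simp only [Matrix.trace, Matrix.diag, Fintype.sum_prod_type]
  exact Finset.sum_congr rfl fun i _ => hN (Matrix.of fun k l => M (i, k) (i, l))

theorem IsCPTP.isPositiveTracePreserving_idTensor {N : Matrix q q ℂ →ₗ[ℂ] Matrix r r ℂ}
    (hN : IsCPTP N) : IsPositiveTracePreserving (idTensor a N) :=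
  ⟨hN.1.posSemidef_idTensor, trace_idTensor hN.2⟩

theorem IsCPTP.nonempty [Nonempty q] {N : Matrix q q ℂ →ₗ[ℂ] Matrix r r ℂ} (hN : IsCPTP N) :
    Nonempty r := by
  obtain ⟨ρ, hρ⟩ := exists_isDensity (n := q)
  by_contra h
  rw [not_nonempty_iff] at h
  have htr := hN.2 ρ
  rw [hρ.2] at htr
  simp [Matrix.trace] at htr

theorem IsCPTP.comp {T : Matrix r r ℂ →ₗ[ℂ] Matrix s s ℂ} {N : Matrix q q ℂ →ₗ[ℂ] Matrix r r ℂ}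
    (hT : IsCPTP T) (hN : IsCPTP N) : IsCPTP (T ∘ₗ N) :=
  ⟨fun k M hM => hT.1 k _ (hN.1 k M hM), fun X => (hT.2 (N X)).trans (hN.2 X)⟩

theorem isCPTP_reindex (e : r ≃ s) :
    IsCPTP (Matrix.reindexLinearEquiv ℂ ℂ e e : Matrix r r ℂ →ₗ[ℂ] Matrix s s ℂ) := by
  refine ⟨fun k M hM => hM.submatrix (Prod.map id e.symm), fun X => ?_⟩
  exact e.symm.sum_comp fun i => X i i

end Channels

section Simulation

variable {u m r s : Type*} [Fintype u] [Nonempty u] [Fintype m] [Fintype r] [Fintype s]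
  [DecidableEq r] [DecidableEq s] {C : Matrix m m ℂ →ₗ[ℂ] Matrix r r ℂ}
  {C' : Matrix m m ℂ →ₗ[ℂ] Matrix s s ℂ}

theorem exists_isPOVM_hsPairing_le (hC : IsPositiveTracePreserving C)
    (hC' : IsPositiveTracePreserving C')
    (h : ∀ (p : u → ℝ) (ρ : u → Matrix m m ℂ), IsProbDist p → (∀ x, IsDensity (ρ x)) →
      pGuess p (fun x => C' (ρ x)) ≤ pGuess p (fun x => C (ρ x)))
    {Q : u → Matrix s s ℂ} (hQ : IsPOVM Q) :
    ∃ P : u → Matrix r r ℂ, IsPOVM P ∧ ∀ ω : u → Matrix m m ℂ, IsEnsemble ω →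
      hsPairing (fun x => C' (ω x)) Q ≤ hsPairing (fun x => C (ω x)) P := by
  refine exists_forall_le_of_forall_exists_le isCompact_setOf_isPOVM convex_setOf_isPOVM
    exists_isPOVM convex_setOf_isEnsemble
    (B := (hsPairing ∘ₗ (C.restrictScalars ℝ).compLeft u).flip)
    (φ := hsPairing.flip Q ∘ₗ (C'.restrictScalars ℝ).compLeft u)
    (fun ω => (hsPairing _).continuous_of_finiteDimensional) fun ω hω => ?_
  obtain ⟨p, ρ, hp, hρ, rfl⟩ := hω.exists_eq_smul
  have hC'ρ := fun x => hC'.isDensity (hρ x)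
  obtain ⟨P, hP, hPg⟩ := exists_isPOVM_pGuess_eq hp fun x => hC.isDensity (hρ x)
  refine ⟨P, hP, ?_⟩
  have hscore := ((pGuess_le_iff hp hC'ρ).1 le_rfl Q hQ).trans ((h p ρ hp hρ).trans hPg.le)
  change hsPairing (fun x => C' (p x • ρ x)) Q ≤ hsPairing (fun x => C (p x • ρ x)) P
  simpa only [LinearMap.map_smul_of_tower] using hscore

theorem exists_isPOVM_trace_mul_eq (hC : IsPositiveTracePreserving C)
    (hC' : IsPositiveTracePreserving C')
    (h : ∀ (p : u → ℝ) (ρ : u → Matrix m m ℂ), IsProbDist p → (∀ x, IsDensity (ρ x)) →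
      pGuess p (fun x => C' (ρ x)) ≤ pGuess p (fun x => C (ρ x)))
    {Q : u → Matrix s s ℂ} (hQ : IsPOVM Q) :
    ∃ P : u → Matrix r r ℂ, IsPOVM P ∧ ∀ x M, (C M * P x).trace = (C' M * Q x).trace := by
  classical
  obtain ⟨P, hP, hPQ⟩ := exists_isPOVM_hsPairing_le hC hC' h hQ
  refine ⟨P, hP, fun x => LinearMap.congr_fun (linearMap_ext_of_isDensity
    (f := Matrix.traceLinearMap r ℂ ℂ ∘ₗ LinearMap.mulRight ℂ (P x) ∘ₗ C)
    (g := Matrix.traceLinearMap s ℂ ℂ ∘ₗ LinearMap.mulRight ℂ (Q x) ∘ₗ C') fun ρ hρ => ?_)⟩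
  have hle : ∀ y, (C' ρ * Q y).trace.re ≤ (C ρ * P y).trace.re := fun y => by
    have hy := hPQ _ (isEnsemble_piSingle hρ y)
    simp only [Pi.apply_single (fun _ => C) (fun _ => map_zero C),
      Pi.apply_single (fun _ => C') (fun _ => map_zero C')] at hy
    simpa only [hsPairing_single_left] using hy
  have hsum : ∑ y, (C' ρ * Q y).trace.re = ∑ y, (C ρ * P y).trace.re := by
    rw [← hsPairing_apply (fun _ => C' ρ), ← hsPairing_apply (fun _ => C ρ), hsPairing_const_left,
      hsPairing_const_left, hP.2, hQ.2, mul_one, mul_one, hC.trace_apply, hC'.trace_apply]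
  have hre := (Finset.sum_eq_sum_iff_of_le fun y _ => hle y).1 hsum x (Finset.mem_univ x)
  change (C ρ * P x).trace = (C' ρ * Q x).trace
  rw [Complex.eq_re_of_ofReal_le (trace_mul_nonneg (hC.posSemidef hρ.1) (hP.1 x)),
    Complex.eq_re_of_ofReal_le (trace_mul_nonneg (hC'.posSemidef hρ.1) (hQ.1 x)), hre]

end Simulation

section UnitaryDesign

/-- Unitary 1-designs: families of unitaries averaging every operator to a multiple of the
identity. The Weyl operators are an example. -/
structure IsUnitaryDesign {u s : Type*} [Fintype u] [Fintype s] [DecidableEq s]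
    (V : u → Matrix s s ℂ) : Prop where
  conjTranspose_mul_self : ∀ x, (V x)ᴴ * V x = 1
  sum_mul_mul_conjTranspose : ∀ X : Matrix s s ℂ,
    ∑ x, V x * X * (V x)ᴴ = (Fintype.card u / Fintype.card s * X.trace : ℂ) • 1

/-- The Weyl operator `|k⟩ ↦ ψ(k) |k + a⟩` of a finite abelian group. -/
def weyl {G : Type*} [AddCommGroup G] [DecidableEq G] (x : G × AddChar G ℂ) : Matrix G G ℂ :=
  Matrix.of fun i k => if i = k + x.1 then x.2 k else 0

variable {G : Type*} [AddCommGroup G] [Fintype G] [DecidableEq G]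

theorem conjTranspose_weyl_mul_self (x : G × AddChar G ℂ) : (weyl x)ᴴ * weyl x = 1 := by
  ext k l
  simp only [weyl, Matrix.mul_apply, Matrix.conjTranspose_apply, Matrix.of_apply, mul_ite, mul_zero,
    Finset.sum_ite_eq', Finset.mem_univ, if_true, Matrix.one_apply, add_left_inj]
  obtain rfl | hkl := eq_or_ne k l
  · simp [← AddChar.map_neg_eq_conj, ← AddChar.map_add_eq_mul]
  · simp [hkl, hkl.symm]

theorem weyl_mul_mul_conjTranspose_apply (x : G × AddChar G ℂ) (X : Matrix G G ℂ) (i j : G) :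
    (weyl x * X * (weyl x)ᴴ) i j = x.2 (i - j) * X (i - x.1) (j - x.1) := by
  simp only [weyl, Matrix.mul_apply, Matrix.conjTranspose_apply, Matrix.of_apply,
    eq_comm (a := i), eq_comm (a := j), ← eq_sub_iff_add_eq]
  simp [apply_ite, ← AddChar.map_neg_eq_conj, mul_right_comm _ (X _ _), ← AddChar.map_add_eq_mul]

theorem isUnitaryDesign_weyl : IsUnitaryDesign (weyl (G := G)) := by
  refine ⟨conjTranspose_weyl_mul_self, fun X => ?_⟩
  ext i j
  simp only [Matrix.sum_apply, weyl_mul_mul_conjTranspose_apply, Fintype.sum_prod_type,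
    ← Finset.sum_mul, AddChar.sum_apply_eq_ite, Fintype.card_prod, AddChar.card_eq, sub_eq_zero,
    ← Finset.mul_sum, Matrix.smul_apply]
  obtain rfl | hij := eq_or_ne i j
  · have hd : (Fintype.card G : ℂ) ≠ 0 := Nat.cast_ne_zero.2 Fintype.card_ne_zero
    have htr : ∑ a, X (i - a) (i - a) = X.trace := (Equiv.subLeft i).sum_comp fun a => X a a
    simp [htr, hd]
  · simp [hij]

theorem IsUnitaryDesign.submatrix {u s t : Type*} [Fintype u] [Fintype s] [DecidableEq s]
    [Fintype t] [DecidableEq t] {V : u → Matrix s s ℂ} (hV : IsUnitaryDesign V) (e : t ≃ s) :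
    IsUnitaryDesign fun x => (V x).submatrix e e := by
  refine ⟨fun x => ?_, fun X => ?_⟩
  · rw [Matrix.conjTranspose_submatrix, Matrix.submatrix_mul_equiv, hV.conjTranspose_mul_self,
      Matrix.submatrix_one_equiv]
  · have hterm : ∀ x, (V x).submatrix e e * X * ((V x).submatrix e e)ᴴ =
        Matrix.reindexAlgEquiv ℂ ℂ e.symm (V x * X.submatrix e.symm e.symm * (V x)ᴴ) := fun x => by
      simp [← Matrix.submatrix_mul_equiv _ _ e e e]
    have htr : (X.submatrix e.symm e.symm).trace = X.trace := e.symm.sum_comp fun i => X i i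
    simp only [hterm]
    rw [← map_sum, hV.sum_mul_mul_conjTranspose, map_smul, map_one, htr, Fintype.card_congr e]

theorem exists_isUnitaryDesign (s : Type*) [Fintype s] [DecidableEq s] [Nonempty s] :
    ∃ (u : Type) (_ : Fintype u) (_ : Nonempty u) (V : u → Matrix s s ℂ), IsUnitaryDesign V := by
  let e : s ≃ ZMod (Fintype.card s) := Fintype.equivOfCardEq (ZMod.card _).symm
  exact ⟨_, inferInstance, inferInstance, _, isUnitaryDesign_weyl.submatrix e⟩

end UnitaryDesign

section ChoiMap

variable {r s : Type*} [Fintype r] [Fintype s] [DecidableEq s]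

/-- The map whose Choi matrix is the transpose of `A`: the measurement operator `A` on
`ℋ_S ⊗ ℋ_R` becomes a map from operators on `ℋ_R` to operators on `ℋ_S`. -/
noncomputable def ofTransposeChoi (A : Matrix (s × r) (s × r) ℂ) :
    Matrix r r ℂ →ₗ[ℂ] Matrix s s ℂ where
  toFun Y := Matrix.of fun i j => ((Matrix.single i j 1 ⊗ₖ Y) * A).trace
  map_add' Y Z := by ext; simp [Matrix.kronecker_add, add_mul]
  map_smul' c Y := by ext; simp [Matrix.kronecker_smul]

theorem ofTransposeChoi_apply (A : Matrix (s × r) (s × r) ℂ) (Y : Matrix r r ℂ) (i j : s) :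
    ofTransposeChoi A Y i j = ((Matrix.single i j 1 ⊗ₖ Y) * A).trace := rfl

theorem ofTransposeChoi_apply_eq_sum (A : Matrix (s × r) (s × r) ℂ) (Y : Matrix r r ℂ) (i j : s) :
    ofTransposeChoi A Y i j = ∑ k, ∑ l, Y k l * Aᵀ (i, k) (j, l) := by
  simp [ofTransposeChoi_apply, Matrix.trace, Matrix.mul_apply, Fintype.sum_prod_type,
    Matrix.single_apply, ite_and]

theorem trace_ofTransposeChoi (A : Matrix (s × r) (s × r) ℂ) (Y : Matrix r r ℂ) :
    (ofTransposeChoi A Y).trace = (((1 : Matrix s s ℂ) ⊗ₖ Y) * A).trace := by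
  calc (ofTransposeChoi A Y).trace
      = ((∑ i, Matrix.single i i 1 ⊗ₖ Y) * A).trace := by
        rw [Matrix.sum_mul, Matrix.trace_sum]
        rfl
    _ = (((1 : Matrix s s ℂ) ⊗ₖ Y) * A).trace := by
        rw [← Matrix.sum_single_one]
        congr 2
        ext
        simp [Matrix.sum_apply, Finset.sum_mul]

theorem posSemidef_sum_blocks {n k : Type*} [Finite n] [Fintype k]
    {A : Matrix (n × k) (n × k) ℂ} (hA : A.PosSemidef) :
    (Matrix.of fun x y => ∑ i, ∑ j, A (x, i) (y, j) : Matrix n n ℂ).PosSemidef := by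
  classical
  cases nonempty_fintype n
  convert hA.conjTranspose_mul_mul_same
    (Matrix.of fun x y => if x.1 = y then 1 else 0 : Matrix (n × k) n ℂ) using 1
  ext x y
  simp only [Matrix.mul_apply, Matrix.conjTranspose_apply, Matrix.of_apply, apply_ite star,
    star_one, star_zero, ite_mul, mul_ite, one_mul, mul_one, zero_mul, mul_zero,
    Fintype.sum_prod_type_right, Finset.sum_ite_eq', Finset.mem_univ, if_true]
  exact Finset.sum_comm

theorem isCompletelyPositive_ofTransposeChoi {A : Matrix (s × r) (s × r) ℂ} (hA : A.PosSemidef) :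
    IsCompletelyPositive (ofTransposeChoi A) := by
  intro k M hM
  convert posSemidef_sum_blocks ((hM.kronecker hA.transpose).submatrix
    fun z : (Fin k × s) × r => ((z.1.1, z.2), (z.1.2, z.2))) using 1
  ext x y
  simp [idTensor, ofTransposeChoi_apply_eq_sum]

end ChoiMap

section BellMeasurement

variable {r s u : Type*} [Fintype r] [DecidableEq r] [Fintype s] [DecidableEq s] [Fintype u]

/-- The unnormalized maximally entangled projection `∑ᵢⱼ |i⟩⟨j| ⊗ |i⟩⟨j|`. -/
def maxEntangled (s : Type*) [DecidableEq s] : Matrix (s × s) (s × s) ℂ :=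
  Matrix.vecMulVec (fun x => if x.1 = x.2 then 1 else 0) (fun x => if x.1 = x.2 then 1 else 0)

theorem posSemidef_maxEntangled {s : Type*} [Finite s] [DecidableEq s] :
    (maxEntangled s).PosSemidef := by
  cases nonempty_fintype s
  convert Matrix.posSemidef_vecMulVec_self_star
    (fun x : s × s => if x.1 = x.2 then (1 : ℂ) else 0) using 1
  ext
  simp [maxEntangled, Matrix.vecMulVec_apply]

theorem trace_single_kronecker_mul_maxEntangled (i j : s) (Z : Matrix s s ℂ) :
    ((Matrix.single i j 1 ⊗ₖ Z) * maxEntangled s).trace = Z i j := by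
  simp [maxEntangled, Matrix.trace, Matrix.mul_apply, Matrix.vecMulVec_apply,
    Fintype.sum_prod_type, Matrix.single_apply, ite_and]

theorem kronecker_one_mul_maxEntangled_mul_apply (V : Matrix s s ℂ) (i j k l : s) :
    ((V ⊗ₖ 1) * maxEntangled s * (V ⊗ₖ 1)ᴴ : Matrix (s × s) (s × s) ℂ) (i, k) (j, l) =
      (V * Matrix.single k l 1 * Vᴴ : Matrix s s ℂ) i j := by
  simp [maxEntangled, Matrix.mul_apply, Matrix.vecMulVec_apply, Fintype.sum_prod_type,
    Matrix.one_apply, Matrix.single_apply, ite_and, apply_ite star]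

omit [DecidableEq s] in
theorem kronecker_one_mul_mul_conjTranspose (V Z : Matrix s s ℂ) (Y : Matrix r r ℂ) :
    (V ⊗ₖ (1 : Matrix r r ℂ)) * (Z ⊗ₖ Y) * (V ⊗ₖ (1 : Matrix r r ℂ))ᴴ = (V * Z * Vᴴ) ⊗ₖ Y := by
  rw [Matrix.conjTranspose_kronecker, Matrix.conjTranspose_one, ← Matrix.mul_kronecker_mul,
    ← Matrix.mul_kronecker_mul, one_mul, mul_one]

variable {V : u → Matrix s s ℂ} {P : u → Matrix (s × r) (s × r) ℂ}

/-- The measurement in the basis of maximally entangled states given by a unitary design. -/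
noncomputable def bellMeasurement (V : u → Matrix s s ℂ) (x : u) : Matrix (s × s) (s × s) ℂ :=
  (Fintype.card s / Fintype.card u : ℝ) •
    ((V x ⊗ₖ 1) * maxEntangled s * (V x ⊗ₖ 1)ᴴ)

theorem isPOVM_bellMeasurement [Nonempty u] [Nonempty s] (hV : IsUnitaryDesign V) :
    IsPOVM (bellMeasurement V) := by
  refine ⟨fun x => (posSemidef_maxEntangled.mul_mul_conjTranspose_same _).smul (by positivity), ?_⟩
  have hsum : ∑ x, (V x ⊗ₖ 1) * maxEntangled s * (V x ⊗ₖ 1)ᴴ =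
      (Fintype.card u / Fintype.card s : ℝ) • (1 : Matrix (s × s) (s × s) ℂ) := by
    ext ⟨i, k⟩ ⟨j, l⟩
    simp only [Matrix.sum_apply, kronecker_one_mul_maxEntangled_mul_apply]
    rw [← Matrix.sum_apply, hV.sum_mul_mul_conjTranspose]
    obtain rfl | hkl := eq_or_ne k l
    · simp [Matrix.one_apply, Prod.ext_iff]
    · simp [hkl, Matrix.one_apply, Prod.ext_iff]
  simp only [bellMeasurement]
  rw [← Finset.smul_sum, hsum, smul_smul, div_mul_div_cancel₀', div_self, one_smul]
  · exact Nat.cast_ne_zero.2 Fintype.card_ne_zero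
  · exact Nat.cast_ne_zero.2 Fintype.card_ne_zero

theorem trace_kronecker_mul_bellMeasurement (hV : IsUnitaryDesign V) (x : u)
    (Z Y : Matrix s s ℂ) :
    (((V x * Z * (V x)ᴴ) ⊗ₖ Y) * bellMeasurement V x).trace =
      (Fintype.card s / Fintype.card u : ℂ) * ((Z ⊗ₖ Y) * maxEntangled s).trace := by
  have hunitary : (V x ⊗ₖ (1 : Matrix s s ℂ))ᴴ * (V x ⊗ₖ 1) = 1 := by
    rw [Matrix.conjTranspose_kronecker, Matrix.conjTranspose_one, ← Matrix.mul_kronecker_mul,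
      hV.conjTranspose_mul_self, one_mul, Matrix.one_kronecker_one]
  have hcancel : ((V x ⊗ₖ 1) * (Z ⊗ₖ Y) * (V x ⊗ₖ 1)ᴴ *
      ((V x ⊗ₖ 1) * maxEntangled s * (V x ⊗ₖ 1)ᴴ)).trace = ((Z ⊗ₖ Y) * maxEntangled s).trace := by
    simp only [mul_assoc]
    rw [Matrix.trace_mul_comm]
    simp only [mul_assoc]
    rw [hunitary, mul_one, ← mul_assoc _ᴴ, hunitary, one_mul]
  rw [bellMeasurement, Matrix.mul_smul, Matrix.trace_smul, ← kronecker_one_mul_mul_conjTranspose,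
    hcancel, Complex.real_smul, Complex.ofReal_div, Complex.ofReal_natCast, Complex.ofReal_natCast]

/-- The measurement operator on `ℋ_S ⊗ ℋ_R` that undoes `V x` on `ℋ_S` before measuring `P x`,
averaged over the outcomes. -/
noncomputable def correctedEffect (V : u → Matrix s s ℂ) (P : u → Matrix (s × r) (s × r) ℂ) :
    Matrix (s × r) (s × r) ℂ :=
  (Fintype.card s : ℝ)⁻¹ • ∑ x, (V x ⊗ₖ 1)ᴴ * P x * (V x ⊗ₖ 1)

omit [DecidableEq s] in
theorem trace_kronecker_mul_correctedEffect (V : u → Matrix s s ℂ)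
    (P : u → Matrix (s × r) (s × r) ℂ) (Z : Matrix s s ℂ) (Y : Matrix r r ℂ) :
    ((Z ⊗ₖ Y) * correctedEffect V P).trace =
      (Fintype.card s : ℂ)⁻¹ * ∑ x, (((V x * Z * (V x)ᴴ) ⊗ₖ Y) * P x).trace := by
  have hcycle : ∀ x, ((Z ⊗ₖ Y) * ((V x ⊗ₖ 1)ᴴ * P x * (V x ⊗ₖ 1))).trace =
      (((V x * Z * (V x)ᴴ) ⊗ₖ Y) * P x).trace := fun x => by
    rw [← kronecker_one_mul_mul_conjTranspose, ← mul_assoc, Matrix.trace_mul_comm]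
    simp only [mul_assoc]
  simp [correctedEffect, Matrix.mul_sum, Matrix.trace_sum, hcycle, Complex.real_smul]

theorem isCPTP_ofTransposeChoi_correctedEffect [Nonempty s] (hV : IsUnitaryDesign V)
    (hP : IsPOVM P) : IsCPTP (ofTransposeChoi (correctedEffect V P)) := by
  refine ⟨isCompletelyPositive_ofTransposeChoi ?_, fun Y => ?_⟩
  · exact (Matrix.posSemidef_sum _ fun x _ => (hP.1 x).conjTranspose_mul_mul_same _).smul
      (by positivity)
  · have hVV : ∀ x, V x * 1 * (V x)ᴴ = 1 := fun x => by
      rw [mul_one, mul_eq_one_comm.1 (hV.conjTranspose_mul_self x)]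
    rw [trace_ofTransposeChoi, trace_kronecker_mul_correctedEffect]
    simp only [hVV]
    rw [← Matrix.trace_sum, ← Matrix.mul_sum, hP.2, mul_one, Matrix.trace_kronecker,
      Matrix.trace_one, inv_mul_cancel_left₀ (Nat.cast_ne_zero.2 Fintype.card_ne_zero)]

theorem eq_ofTransposeChoi_correctedEffect_comp {q : Type*} [Nonempty u]
    (hV : IsUnitaryDesign V) {N : Matrix q q ℂ →ₗ[ℂ] Matrix r r ℂ}
    {N' : Matrix q q ℂ →ₗ[ℂ] Matrix s s ℂ}
    (h : ∀ x M, (idTensor s N M * P x).trace = (idTensor s N' M * bellMeasurement V x).trace) :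
    N' = ofTransposeChoi (correctedEffect V P) ∘ₗ N := by
  refine LinearMap.ext fun X => Matrix.ext fun i j => ?_
  have houtcome : ∀ x, (((V x * Matrix.single i j 1 * (V x)ᴴ) ⊗ₖ N X) * P x).trace =
      (Fintype.card s / Fintype.card u : ℂ) * N' X i j := fun x => by
    rw [← idTensor_kronecker, h, idTensor_kronecker, trace_kronecker_mul_bellMeasurement hV,
      trace_single_kronecker_mul_maxEntangled]
  have : Nonempty s := ⟨i⟩
  have hs : (Fintype.card s : ℂ) ≠ 0 := Nat.cast_ne_zero.2 Fintype.card_ne_zero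
  have hu : (Fintype.card u : ℂ) ≠ 0 := Nat.cast_ne_zero.2 Fintype.card_ne_zero
  rw [LinearMap.comp_apply, ofTransposeChoi_apply, trace_kronecker_mul_correctedEffect,
    Finset.sum_congr rfl fun x _ => houtcome x, Finset.sum_const, Finset.card_univ, nsmul_eq_mul]
  field_simp

end BellMeasurement

section Degradability

variable {a q r s : Type*} [Fintype a] [DecidableEq a] [Fintype q] [Fintype r] [DecidableEq r]
  [Fintype s] [DecidableEq s] {N : Matrix q q ℂ →ₗ[ℂ] Matrix r r ℂ}
  {N' : Matrix q q ℂ →ₗ[ℂ] Matrix s s ℂ}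

theorem IsDegradableInto.pGuess_le (h : IsDegradableInto N N') (hN : IsCPTP N) {u : Type*}
    [Fintype u] {p : u → ℝ} (hp : IsProbDist p) {ρ : u → Matrix (a × q) (a × q) ℂ}
    (hρ : ∀ x, IsDensity (ρ x)) :
    pGuess p (fun x => idTensor a N' (ρ x)) ≤ pGuess p (fun x => idTensor a N (ρ x)) := by
  obtain ⟨T, hT, rfl⟩ := h
  simp only [idTensor_comp_apply]
  exact hT.isPositiveTracePreserving_idTensor.pGuess_le hp fun x =>
    hN.isPositiveTracePreserving_idTensor.isDensity (hρ x)

theorem isDegradableInto_of_forall_pGuess_le [Nonempty s] (hN : IsCPTP N) (hN' : IsCPTP N')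
    (h : ∀ (u : Type) [Fintype u] (p : u → ℝ) (ρ : u → Matrix (s × q) (s × q) ℂ),
      IsProbDist p → (∀ x, IsDensity (ρ x)) →
        pGuess p (fun x => idTensor s N' (ρ x)) ≤ pGuess p (fun x => idTensor s N (ρ x))) :
    IsDegradableInto N N' := by
  obtain ⟨u, _, _, V, hV⟩ := exists_isUnitaryDesign s
  obtain ⟨P, hP, hPQ⟩ := exists_isPOVM_trace_mul_eq hN.isPositiveTracePreserving_idTensor
    hN'.isPositiveTracePreserving_idTensor (h u) (isPOVM_bellMeasurement hV)
  exact ⟨_, isCPTP_ofTransposeChoi_correctedEffect hV hP,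
    eq_ofTransposeChoi_correctedEffect_comp hV hPQ⟩

theorem isDegradableInto_of_card_eq_of_forall_pGuess_le [Nonempty q] (hN : IsCPTP N)
    (hN' : IsCPTP N') (hcard : Fintype.card a = Fintype.card s)
    (h : ∀ (u : Type) [Fintype u] (p : u → ℝ) (ρ : u → Matrix (a × q) (a × q) ℂ),
      IsProbDist p → (∀ x, IsDensity (ρ x)) →
        pGuess p (fun x => idTensor a N' (ρ x)) ≤ pGuess p (fun x => idTensor a N (ρ x))) :
    IsDegradableInto N N' := by
  have := hN'.nonempty
  let e : a ≃ s := Fintype.equivOfCardEq hcard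
  have := e.nonempty
  let relabel : Matrix s s ℂ →ₗ[ℂ] Matrix a a ℂ := Matrix.reindexLinearEquiv ℂ ℂ e.symm e.symm
  have hrelabel : IsDegradableInto N' (relabel ∘ₗ N') := ⟨relabel, isCPTP_reindex e.symm, rfl⟩
  obtain ⟨T, hT, hTN⟩ := isDegradableInto_of_forall_pGuess_le hN
    ((isCPTP_reindex e.symm).comp hN') fun u _ p ρ hp hρ =>
      (hrelabel.pGuess_le hN' hp hρ).trans (h u p ρ hp hρ)
  refine ⟨_, (isCPTP_reindex e).comp hT, ?_⟩
  rw [LinearMap.comp_assoc, ← hTN]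
  ext
  simp

end Degradability

end QuantumComparison

open QuantumComparison in
theorem mainTheorem3 {q r s s' : Type*} [Fintype q] [DecidableEq q] [Nonempty q]
    [Fintype r] [DecidableEq r] [Fintype s] [DecidableEq s] [Fintype s'] [DecidableEq s']
    (hs' : Fintype.card s' = Fintype.card s)
    (N : Matrix q q ℂ →ₗ[ℂ] Matrix r r ℂ) (N' : Matrix q q ℂ →ₗ[ℂ] Matrix s s ℂ)
    (hN : IsCPTP N) (hN' : IsCPTP N') :
    [ ∀ (U : Type) [Fintype U] [DecidableEq U] (p : U → ℝ)
        (ρ : U → Matrix (s' × q) (s' × q) ℂ), IsProbDist p → (∀ u, IsDensity (ρ u)) →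
        condMinEntropy (cqState p fun u => idTensor s' N (ρ u)) ≤
          condMinEntropy (cqState p fun u => idTensor s' N' (ρ u)),
      ∀ (U : Type) [Fintype U] (p : U → ℝ)
        (ρ : U → Matrix (s' × q) (s' × q) ℂ), IsProbDist p → (∀ u, IsDensity (ρ u)) →
        pGuess p (fun u => idTensor s' N (ρ u)) ≥ pGuess p (fun u => idTensor s' N' (ρ u)),
      IsDegradableInto N N' ].TFAE := by
  have hentropy {u : Type} [Fintype u] [DecidableEq u] {p : u → ℝ}
      {ρ : u → Matrix (s' × q) (s' × q) ℂ} (hp : IsProbDist p) (hρ : ∀ x, IsDensity (ρ x)) :=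
    condMinEntropy_cqState_le_iff hp
      (fun x => hN.isPositiveTracePreserving_idTensor.isDensity (hρ x))
      (fun x => hN'.isPositiveTracePreserving_idTensor.isDensity (hρ x))
  classical
  tfae_have 1 → 2 := fun h u _ p ρ hp hρ => (hentropy hp hρ).1 (h u p ρ hp hρ)
  tfae_have 2 → 1 := fun h u _ _ p ρ hp hρ => (hentropy hp hρ).2 (h u p ρ hp hρ)
  tfae_have 2 → 3 := isDegradableInto_of_card_eq_of_forall_pGuess_le hN hN' hs'
  tfae_have 3 → 2 := fun h u _ p ρ hp hρ => h.pGuess_le hN hp hρ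
  tfae_finish
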